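/- Consider the $K$-armed dueling bandit problem: an instance is given by gaps $\epsilon_{i,j}\in(-\tfrac12,\tfrac12)$ with $\epsilon_{j,i}=-\epsilon_{i,j}$, for $i,j\in[K]$; a comparison of the arms $b_i,b_j$ (possibly $i=j$) is won by $b_i$ with probability $\tfrac12+\epsilon_{i,j}$, independently of all other comparisons. The instance satisfies SST and STI if there is a total ordering $\succeq$ of the arms such that $\epsilon_{i,k}\ge\max\{\epsilon_{i,j},\epsilon_{j,k}\}$ and $\epsilon_{i,k}\le\epsilon_{i,j}+\epsilon_{j,k}$ whenever $b_i\succeq b_j\succeq b_k$. An arm $b^*$ is a Condorcet winner if it beats every other arm with probability at least $\tfrac12$; write $\epsilon_j$ for the gap between $b^*$ and $b_j$, and $\epsilon_{\min}=\min\{\epsilon_j:\epsilon_j>0\}$. An algorithm with horizon $T$ using at most $B$ batches makes $T$ comparisons in at most $B$ rounds; it may be randomized, and it chooses the (adaptively sized) list of comparisons of each round as a function of the outcomes of the earlier rounds only. A comparison of $b_i$ and $b_j$ incurs regret $(\epsilon_i+\epsilon_j)/2$, and $R(T)$ is the total regret of the $T$ comparisons. **Theorem.** There is an absolute constant $c>0$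 such that the following holds for all integers $B>1$, $K\ge 2$ and $T\ge K$ for which $K\le 36B^2$ or $T\ge K^B$ (so, for any fixed $K$ and $B$, for all sufficiently large $T$). For every algorithm with horizon $T$ that uses at most $B$ batches there is a $K$-armed instance that satisfies SST and STI and has a Condorcet winner and at least one arm of positive gap, such that $$\mathbb E[R(T)]\;\ge\; c\cdot\frac{K\,T^{1/B}}{B^2\,\epsilon_{\min}},$$ where $\epsilon_{\min}$ is the smallest positive gap of that particular instance. -/

import Mathlib

noncomputable section

namespace DuelingBandit

/-- An instance of the `K`-armed dueling bandit problem: the gap matrix `ε`, with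
`P i j = 1/2 + ε i j` the probability that arm `i` wins a comparison against arm `j`. -/
structure Instance (K : ℕ) where
  gap : Fin K → Fin K → ℝ
  antisymm : ∀ i j, gap j i = -gap i j
  lower : ∀ i j, -(1 / 2) < gap i j
  upper : ∀ i j, gap i j < 1 / 2

namespace Instance

variable {K : ℕ} (I : Instance K)

/-- The probability that arm `i` wins a comparison against arm `j`. -/
def prob (i j : Fin K) : ℝ := 1 / 2 + I.gap i j

/-- Arm `i` is a Condorcet winner. -/
def IsCondorcetWinner (i : Fin K) : Prop := ∀ j, j ≠ i → 1 / 2 ≤ I.prob i j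

/-- Strong stochastic transitivity with respect to the ordering `b_i ⪰ b_j ↔ rank i ≤ rank j`. -/
def SST (rank : Equiv.Perm (Fin K)) : Prop :=
  ∀ i j k, rank i ≤ rank j → rank j ≤ rank k → max (I.gap i j) (I.gap j k) ≤ I.gap i k

/-- The stochastic triangle inequality for the ordering `b_i ⪰ b_j ↔ rank i ≤ rank j`. -/
def STI (rank : Equiv.Perm (Fin K)) : Prop :=
  ∀ i j k, rank i ≤ rank j → rank j ≤ rank k → I.gap i k ≤ I.gap i j + I.gap j k

/-- `e` is the smallest non-zero gap between the best arm `best` and another arm. In particular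
some arm has a positive gap. -/
def IsMinGap (best : Fin K) (e : ℝ) : Prop :=
  IsLeast {x : ℝ | 0 < x ∧ ∃ j, x = I.gap best j} e

theorem prob_nonneg (i j : Fin K) : 0 ≤ I.prob i j := by
  have := I.lower i j
  unfold prob
  linarith

theorem prob_le_one (i j : Fin K) : I.prob i j ≤ 1 := by
  have := I.upper i j
  unfold prob
  linarith

/-- The law of the outcome of one comparison of the arms `q.1` and `q.2`; the value `true` means
that `q.1` wins. -/
def outcome (q : Fin K × Fin K) : PMF Bool :=
  PMF.ofFintype (fun w => ENNReal.ofReal (cond w (I.prob q.1 q.2) (1 - I.prob q.1 q.2))) (by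
    have h0 := I.prob_nonneg q.1 q.2
    have h1 := I.prob_le_one q.1 q.2
    rw [Fintype.sum_bool]
    simp only [cond_true, cond_false]
    rw [← ENNReal.ofReal_add h0 (by linarith)]
    simp)

end Instance

/-- A batch: a list of comparisons (of two arms, possibly the same). -/
abbrev Batch (K : ℕ) := List (Fin K × Fin K)

/-- A batch together with the outcomes of its comparisons. -/
abbrev Feedback (K : ℕ) := List ((Fin K × Fin K) × Bool)

/-- What has been observed so far: the feedback of every batch, oldest batch first. -/
abbrev History (K : ℕ) := List (Feedback K)

/-- The total number of comparisons made in a history. -/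
def History.size {K : ℕ} (h : History K) : ℕ := h.flatten.length

/-- The joint law of the feedback of a batch: the outcomes are independent. -/
def Instance.feedback {K : ℕ} (I : Instance K) : Batch K → PMF (Feedback K)
  | [] => PMF.pure []
  | q :: qs => (I.outcome q).bind fun w => (I.feedback qs).bind fun o => PMF.pure ((q, w) :: o)

/-- A (possibly randomized) algorithm with time horizon `T` that uses at most `B` batches, with
adaptively chosen batch sizes. After each batch it picks the next batch from everything observed.
A batch may be empty, so that fewer than `B` batches may be used; the batches never exceed the
horizon `T`, and the last one brings the total number of comparisons to exactly `T`. -/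
structure Algorithm (K T B : ℕ) where
  next : History K → PMF (Batch K)
  size_le : ∀ h : History K, h.length < B → h.size ≤ T →
    ∀ q ∈ (next h).support, h.size + q.length ≤ T
  size_eq : ∀ h : History K, h.length + 1 = B → h.size ≤ T →
    ∀ q ∈ (next h).support, h.size + q.length = T

/-- The law of the history after `r` batches when algorithm `A` is run on instance `I`. -/
def law {K T B : ℕ} (A : Algorithm K T B) (I : Instance K) : ℕ → PMF (History K)
  | 0 => PMF.pure []
  | r + 1 => (law A I r).bind fun h => (A.next h).bind fun q =>
      (I.feedback q).bind fun o => PMF.pure (h ++ [o])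

/-- The cumulative regret of a history with respect to the best arm `best`: a comparison of the
arms `i` and `j` costs `(ε_{best,i} + ε_{best,j}) / 2`. -/
def regret {K : ℕ} (I : Instance K) (best : Fin K) (h : History K) : ℝ :=
  (h.flatten.map fun o => (I.gap best o.1.1 + I.gap best o.1.2) / 2).sum

/-- The expected regret `E[R(T)]` of algorithm `A` on instance `I` with best arm `best`. Only
finitely many histories have positive probability. -/
def expectedRegret {K T B : ℕ} (A : Algorithm K T B) (I : Instance K) (best : Fin K) : ℝ :=
  ∑' h : History K, (law A I B h).toReal * regret I best h

end DuelingBandit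

end

namespace DuelingBandit

open scoped ENNReal

/-! Suppose the regret is at most `K a / (24576 B² d)`, with `a = T^(1/B)`, on every `pairInstance i
j d D`; its smallest positive gap is `d`, so refuting this (`SmallRegret`) gives the theorem.

A batch is chosen before its outcomes are seen, so its size and its cost depend only on the earlier
feedback. Compare the instance of `(i, j)` with that of `(j, i)`. Each comparison costs at least `d`
in the two together, so an algorithm that cannot separate them pays for a large batch in one of
them. The reference law is that of `tieInstance`. Averaged over ordered pairs, one comparison
carries relative entropy `O(D² / K)`, since it involves only two arms. With `D = d`, about `K / (B
d²)` comparisons reveal too little, so a jump to `N` comparisons with `N d² ≳ K a / B` contradicts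
small regret unless its probability is at most `1 / (4B)` (`prob_large_batch_le`). By induction the
number of comparisons stays below a geometric sequence of thresholds, except with probability `r /
(4B)` after `r` batches.

If `K ≤ 36 B²`, ratio `a / 2` (or `1` if larger) keeps the last threshold below `T`, which is absurd
because exactly `T` comparisons are made.

If `K ≤ a`, ratio `a` is used, and only up to batch `B - 1`. With constant probability the last two
batches start early and the last has at least `T / 2` comparisons. Now the top two arms lead by a
larger gap `D` and differ by `d`. Before the penultimate batch `D` is invisible, so that batch does
not know which pair is on top. Within it only comparisons of `i` with `j` inform about `d`, and
averaging over pairs divides by `K²` instead of `K` (`prob_two_short_batches_le`). This recovers the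
factor `K` in the last batch.

Change of measure uses `L - 1 - log L` in place of `-log L`: it is nonnegative, so it can be
truncated to short histories. -/

/-- The expectation of a nonnegative function under a probability mass function. -/
noncomputable def ev {α : Type*} (p : PMF α) (f : α → ℝ≥0∞) : ℝ≥0∞ := ∑' x, p x * f x

/-! ### Expectations with values in `ℝ≥0∞` -/

section Expectation

variable {α β : Type*}

theorem ev_pure (a : α) (f : α → ℝ≥0∞) : ev (PMF.pure a) f = f a := by
  unfold ev
  rw [tsum_eq_single a]
  · simp
  · intro b hb
    simp [hb]

theorem ev_bind (p : PMF α) (g : α → PMF β) (f : β → ℝ≥0∞) :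
    ev (p.bind g) f = ev p fun x => ev (g x) f := by
  simp only [ev, PMF.bind_apply, ← ENNReal.tsum_mul_right, ← ENNReal.tsum_mul_left]
  rw [ENNReal.tsum_comm]
  simp only [mul_assoc]

theorem ev_add (p : PMF α) (f g : α → ℝ≥0∞) : (ev p fun x => f x + g x) = ev p f + ev p g := by
  simp only [ev, mul_add, ENNReal.tsum_add]

theorem ev_const_mul (p : PMF α) (c : ℝ≥0∞) (f : α → ℝ≥0∞) :
    (ev p fun x => c * f x) = c * ev p f := by
  simp only [ev, ← ENNReal.tsum_mul_left, mul_left_comm]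

theorem ev_const (p : PMF α) (c : ℝ≥0∞) : (ev p fun _ => c) = c := by
  simp only [ev, ENNReal.tsum_mul_right, PMF.tsum_coe, one_mul]

theorem ev_mono_support (p : PMF α) {f g : α → ℝ≥0∞} (h : ∀ x ∈ p.support, f x ≤ g x) :
    ev p f ≤ ev p g := by
  refine ENNReal.tsum_le_tsum fun x => ?_
  by_cases hx : x ∈ p.support
  · exact mul_le_mul_right (h x hx) _
  · rw [PMF.mem_support_iff, not_not] at hx
    simp [hx]

theorem ev_mono (p : PMF α) {f g : α → ℝ≥0∞} (h : ∀ x, f x ≤ g x) : ev p f ≤ ev p g :=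
  ev_mono_support p fun x _ => h x

theorem ev_congr_support (p : PMF α) {f g : α → ℝ≥0∞} (h : ∀ x ∈ p.support, f x = g x) :
    ev p f = ev p g :=
  le_antisymm (ev_mono_support p fun x hx => (h x hx).le)
    (ev_mono_support p fun x hx => (h x hx).ge)

theorem ev_finset_sum {ι : Type*} (p : PMF α) (s : Finset ι) (f : ι → α → ℝ≥0∞) :
    (ev p fun x => ∑ i ∈ s, f i x) = ∑ i ∈ s, ev p (f i) := by
  classical
  induction s using Finset.induction_on with
  | empty => simp [ev]
  | insert i s hi ih => simp only [Finset.sum_insert hi, ev_add, ih]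

theorem ev_indicator_le_one (p : PMF α) (P : α → Prop) [DecidablePred P] :
    (ev p fun x => if P x then 1 else 0) ≤ 1 := by
  refine (ev_mono p (g := fun _ => 1) fun x => ?_).trans_eq (ev_const p 1)
  split_ifs <;> simp

end Expectation

/-! ### The law of the history -/

section Law

variable {K T B : ℕ}

theorem ev_law_zero (A : Algorithm K T B) (I : Instance K) (f : History K → ℝ≥0∞) :
    ev (law A I 0) f = f [] := ev_pure _ _

theorem ev_law_succ (A : Algorithm K T B) (I : Instance K) (r : ℕ) (f : History K → ℝ≥0∞) :
    ev (law A I (r + 1)) f =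
      ev (law A I r) fun h => ev (A.next h) fun q => ev (I.feedback q) fun o => f (h ++ [o]) := by
  simp only [law, ev_bind, ev_pure]

theorem ev_feedback_nil (I : Instance K) (f : Feedback K → ℝ≥0∞) :
    ev (I.feedback []) f = f [] := ev_pure _ _

theorem ev_feedback_cons (I : Instance K) (x : Fin K × Fin K) (q : Batch K)
    (f : Feedback K → ℝ≥0∞) :
    ev (I.feedback (x :: q)) f =
      ev (I.outcome x) fun w => ev (I.feedback q) fun o => f ((x, w) :: o) := by
  simp only [Instance.feedback, ev_bind, ev_pure]

theorem map_fst_of_mem_support_feedback (I : Instance K) (q : Batch K) :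
    ∀ o ∈ (I.feedback q).support, o.map Prod.fst = q := by
  induction q with
  | nil => intro o ho; simpa [Instance.feedback] using ho
  | cons x q ih =>
    intro o ho
    simp only [Instance.feedback, PMF.mem_support_bind_iff, PMF.mem_support_pure_iff] at ho
    obtain ⟨w, -, o', ho', rfl⟩ := ho
    simp [ih o' ho']

theorem length_of_mem_support_feedback (I : Instance K) (q : Batch K) {o : Feedback K}
    (ho : o ∈ (I.feedback q).support) : o.length = q.length := by
  rw [← map_fst_of_mem_support_feedback I q o ho, List.length_map]

theorem History.size_append_singleton (h : History K) (o : Feedback K) :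
    History.size (h ++ [o]) = h.size + o.length := by
  simp [History.size]

theorem length_of_mem_support_law (A : Algorithm K T B) (I : Instance K) (r : ℕ) :
    ∀ h ∈ (law A I r).support, h.length = r := by
  induction r with
  | zero => intro h hh; simp only [law, PMF.mem_support_pure_iff] at hh; simp [hh]
  | succ r ih =>
    intro h hh
    simp only [law, PMF.mem_support_bind_iff, PMF.mem_support_pure_iff] at hh
    obtain ⟨h', hh', q, -, o, -, rfl⟩ := hh
    simp [ih h' hh']

theorem size_le_of_mem_support_law (A : Algorithm K T B) (I : Instance K) (r : ℕ) (hr : r ≤ B) :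
    ∀ h ∈ (law A I r).support, h.size ≤ T := by
  induction r with
  | zero => intro h hh; simp only [law, PMF.mem_support_pure_iff] at hh; simp [hh, History.size]
  | succ r ih =>
    intro h hh
    simp only [law, PMF.mem_support_bind_iff, PMF.mem_support_pure_iff] at hh
    obtain ⟨h', hh', q, hq, o, ho, rfl⟩ := hh
    rw [History.size_append_singleton, length_of_mem_support_feedback I q ho]
    refine A.size_le h' ?_ (ih (by omega) h' hh') q hq
    rw [length_of_mem_support_law A I r h' hh']
    omega

theorem size_eq_of_mem_support_law (A : Algorithm K T B) (I : Instance K) (hB : 0 < B) :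
    ∀ h ∈ (law A I B).support, h.size = T := by
  obtain ⟨r, rfl⟩ : ∃ r, B = r + 1 := ⟨B - 1, by omega⟩
  intro h hh
  simp only [law, PMF.mem_support_bind_iff, PMF.mem_support_pure_iff] at hh
  obtain ⟨h', hh', q, hq, o, ho, rfl⟩ := hh
  rw [History.size_append_singleton, length_of_mem_support_feedback I q ho]
  exact A.size_eq h' (by rw [length_of_mem_support_law A I r h' hh'])
    (size_le_of_mem_support_law A I r (by omega) h' hh') q hq

theorem ev_law_mono (A : Algorithm K T B) (I : Instance K) (f : History K → ℝ≥0∞)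
    (hf : ∀ h o, f h ≤ f (h ++ [o])) {r s : ℕ} (hrs : r ≤ s) :
    ev (law A I r) f ≤ ev (law A I s) f := by
  induction s, hrs using Nat.le_induction with
  | base => exact le_rfl
  | succ s _ ih =>
    refine ih.trans ?_
    rw [ev_law_succ]
    refine ev_mono _ fun h => ?_
    calc f h = ev (A.next h) fun q => ev (I.feedback q) fun _ => f h := by simp only [ev_const]
      _ ≤ _ := ev_mono _ fun q => ev_mono _ fun o => hf h o

end Law

/-! ### Change of measure and relative entropy -/

section Likelihood

variable {K T B : ℕ}

/-- The probability that the comparison `x.1` has the outcome `x.2`. -/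
noncomputable def Instance.outcomeProb (I : Instance K) (x : (Fin K × Fin K) × Bool) : ℝ :=
  cond x.2 (I.prob x.1.1 x.1.2) (1 - I.prob x.1.1 x.1.2)

theorem Instance.outcomeProb_pos (I : Instance K) (x : (Fin K × Fin K) × Bool) :
    0 < I.outcomeProb x := by
  have h1 := I.lower x.1.1 x.1.2
  have h2 := I.upper x.1.1 x.1.2
  obtain ⟨q, w⟩ := x
  cases w <;> simp only [outcomeProb, Instance.prob, cond_true, cond_false] <;> linarith

theorem Instance.outcomeProb_add (I : Instance K) (x : Fin K × Fin K) :
    I.outcomeProb (x, true) + I.outcomeProb (x, false) = 1 := by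
  simp [outcomeProb]

theorem ev_outcome (I : Instance K) (x : Fin K × Fin K) (f : Bool → ℝ≥0∞) :
    ev (I.outcome x) f = ENNReal.ofReal (I.outcomeProb (x, true)) * f true +
      ENNReal.ofReal (I.outcomeProb (x, false)) * f false := by
  simp only [ev, tsum_fintype, Fintype.sum_bool, Instance.outcome, PMF.ofFintype_apply]
  rfl

/-- The likelihood ratio of the feedback `o` for the instances `I` and `J`. -/
noncomputable def likelihoodRatio (I J : Instance K) (o : Feedback K) : ℝ :=
  (o.map fun x => I.outcomeProb x / J.outcomeProb x).prod

theorem likelihoodRatio_nil (I J : Instance K) : likelihoodRatio I J [] = 1 := rfl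

theorem likelihoodRatio_cons (I J : Instance K) (x : (Fin K × Fin K) × Bool) (o : Feedback K) :
    likelihoodRatio I J (x :: o) =
      I.outcomeProb x / J.outcomeProb x * likelihoodRatio I J o := by
  simp [likelihoodRatio]

theorem likelihoodRatio_append (I J : Instance K) (o o' : Feedback K) :
    likelihoodRatio I J (o ++ o') = likelihoodRatio I J o * likelihoodRatio I J o' := by
  simp [likelihoodRatio]

theorem likelihoodRatio_pos (I J : Instance K) (o : Feedback K) :
    0 < likelihoodRatio I J o := by
  induction o with
  | nil => simp [likelihoodRatio_nil]
  | cons x o ih =>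
    rw [likelihoodRatio_cons]
    exact mul_pos (div_pos (I.outcomeProb_pos x) (J.outcomeProb_pos x)) ih

theorem ev_feedback_change (I J : Instance K) (q : Batch K) (f : Feedback K → ℝ≥0∞) :
    ev (I.feedback q) f =
      ev (J.feedback q) fun o => ENNReal.ofReal (likelihoodRatio I J o) * f o := by
  induction q generalizing f with
  | nil => simp [ev_feedback_nil, likelihoodRatio_nil]
  | cons x q ih =>
    have key : ∀ w, ENNReal.ofReal (I.outcomeProb (x, w)) =
        ENNReal.ofReal (J.outcomeProb (x, w)) *
          ENNReal.ofReal (I.outcomeProb (x, w) / J.outcomeProb (x, w)) := by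
      intro w
      rw [← ENNReal.ofReal_mul (J.outcomeProb_pos _).le,
        mul_div_cancel₀ _ (J.outcomeProb_pos _).ne']
    have hnn : ∀ w, 0 ≤ I.outcomeProb (x, w) / J.outcomeProb (x, w) := fun w =>
      (div_pos (I.outcomeProb_pos _) (J.outcomeProb_pos _)).le
    simp only [ev_feedback_cons, ih, ev_outcome, likelihoodRatio_cons, ENNReal.ofReal_mul (hnn _),
      mul_assoc, ev_const_mul]
    rw [key true, key false]
    simp only [mul_assoc]

/-- The choice of batches has the same conditional law under both instances, so it cancels and only
outcome probabilities remain in the ratio. -/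
theorem ev_law_change (A : Algorithm K T B) (I J : Instance K) (r : ℕ) (f : History K → ℝ≥0∞) :
    ev (law A I r) f =
      ev (law A J r) fun h => ENNReal.ofReal (likelihoodRatio I J h.flatten) * f h := by
  induction r generalizing f with
  | zero => simp [ev_law_zero, likelihoodRatio_nil]
  | succ r ih =>
    simp only [ev_law_succ, ih, List.flatten_append, List.flatten_singleton,
      likelihoodRatio_append, ENNReal.ofReal_mul (likelihoodRatio_pos I J _).le, mul_assoc,
      ev_const_mul]
    simp only [ev_feedback_change I J]

/-- The function `L - 1 - log L`, the integrand of a relative entropy. -/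
noncomputable def entropyGap (L : ℝ) : ℝ := L - 1 - Real.log L

theorem entropyGap_nonneg {L : ℝ} (hL : 0 < L) : 0 ≤ entropyGap L := by
  have := Real.log_le_sub_one_of_pos hL
  unfold entropyGap
  linarith

/-- From `log √L ≤ √L - 1`, the right side is at least `2 (√L - 1/2)² + 1/2`. A small likelihood
ratio must therefore be paid for in entropy. -/
theorem half_le_add_entropyGap {L : ℝ} (hL : 0 < L) : 1 / 2 ≤ L + entropyGap L := by
  have h := Real.log_le_sub_one_of_pos (Real.sqrt_pos.2 hL)
  rw [Real.log_sqrt hL.le] at h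
  have h2 := Real.sq_sqrt hL.le
  unfold entropyGap
  nlinarith [sq_nonneg (Real.sqrt L - 1 / 2)]

/-- The relative entropy of the outcome of the comparison `x` under `J` with respect to `I`. -/
noncomputable def relEntropy (I J : Instance K) (x : Fin K × Fin K) : ℝ :=
  -(J.outcomeProb (x, true) * Real.log (I.outcomeProb (x, true) / J.outcomeProb (x, true)) +
    J.outcomeProb (x, false) * Real.log (I.outcomeProb (x, false) / J.outcomeProb (x, false)))

theorem relEntropy_nonneg (I J : Instance K) (x : Fin K × Fin K) : 0 ≤ relEntropy I J x := by
  have key : ∀ w, J.outcomeProb (x, w) *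
      Real.log (I.outcomeProb (x, w) / J.outcomeProb (x, w)) ≤
        I.outcomeProb (x, w) - J.outcomeProb (x, w) := by
    intro w
    have hJ := J.outcomeProb_pos (x, w)
    have h := Real.log_le_sub_one_of_pos (div_pos (I.outcomeProb_pos (x, w)) hJ)
    calc _ ≤ J.outcomeProb (x, w) * (I.outcomeProb (x, w) / J.outcomeProb (x, w) - 1) :=
          mul_le_mul_of_nonneg_left h hJ.le
      _ = _ := by field_simp
  have h1 := key true
  have h2 := key false
  have h3 := I.outcomeProb_add x
  have h4 := J.outcomeProb_add x
  unfold relEntropy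
  linarith

theorem relEntropy_eq_zero {I J : Instance K} {x : Fin K × Fin K}
    (h : I.gap x.1 x.2 = J.gap x.1 x.2) : relEntropy I J x = 0 := by
  have : ∀ w, I.outcomeProb (x, w) = J.outcomeProb (x, w) := by
    intro w
    simp [Instance.outcomeProb, Instance.prob, h]
  simp [relEntropy, this, div_self (J.outcomeProb_pos _).ne']

/-- Against a fair coin the entropy is `-log (1 - 4g²) / 2`, where the terms linear in `g` have
cancelled. -/
theorem relEntropy_le {I J : Instance K} {x : Fin K × Fin K} (hJ : J.gap x.1 x.2 = 0)
    {d : ℝ} (hd : |I.gap x.1 x.2| ≤ d) (hd' : d ≤ 1 / 4) : relEntropy I J x ≤ 3 * d ^ 2 := by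
  set g := I.gap x.1 x.2 with hg
  have hgd : g ^ 2 ≤ d ^ 2 := sq_le_sq' (by linarith [neg_abs_le g]) (by linarith [le_abs_self g])
  have hd0 : 0 ≤ d := (abs_nonneg g).trans hd
  have hg1 : g ^ 2 ≤ 1 / 16 := by nlinarith
  have ht : I.outcomeProb (x, true) / J.outcomeProb (x, true) = 1 + 2 * g := by
    simp only [Instance.outcomeProb, Instance.prob, cond_true, hJ, ← hg]
    ring
  have hf : I.outcomeProb (x, false) / J.outcomeProb (x, false) = 1 - 2 * g := by
    simp only [Instance.outcomeProb, Instance.prob, cond_false, hJ, ← hg]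
    ring
  have hJt : J.outcomeProb (x, true) = 1 / 2 := by
    simp [Instance.outcomeProb, Instance.prob, hJ]
  have hJf : J.outcomeProb (x, false) = 1 / 2 := by
    simp [Instance.outcomeProb, Instance.prob, hJ]; norm_num
  have h1 : 0 < 1 + 2 * g := by linarith [neg_abs_le g]
  have h2 : 0 < 1 - 2 * g := by linarith [le_abs_self g]
  have hlog : Real.log (1 + 2 * g) + Real.log (1 - 2 * g) = Real.log (1 - 4 * g ^ 2) := by
    rw [← Real.log_mul h1.ne' h2.ne']
    ring_nf
  have h3 : 0 < 1 - 4 * g ^ 2 := by linarith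
  have h4 := Real.one_sub_inv_le_log_of_pos h3
  have h5 : (1 - 4 * g ^ 2)⁻¹ ≤ 1 + 6 * g ^ 2 := by
    rw [inv_le_iff_one_le_mul₀ h3]
    nlinarith [sq_nonneg g]
  unfold relEntropy
  rw [ht, hf, hJt, hJf]
  linarith

/-- Under `J` the ratio has mean one, and its logarithm is additive over comparisons. The free
factor `L` carries the ratio of an earlier history, possibly taken against another reference
instance. -/
theorem ev_feedback_entropyGap (I J : Instance K) (q : Batch K) {L : ℝ} (hL : 0 < L) :
    (ev (J.feedback q) fun o => ENNReal.ofReal (entropyGap (L * likelihoodRatio I J o))) =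
      ENNReal.ofReal (entropyGap L + (q.map (relEntropy I J)).sum) := by
  induction q generalizing L with
  | nil => simp [ev_feedback_nil, likelihoodRatio_nil]
  | cons x q ih =>
    have hr : ∀ w, 0 < I.outcomeProb (x, w) / J.outcomeProb (x, w) := fun w =>
      div_pos (I.outcomeProb_pos _) (J.outcomeProb_pos _)
    have hs : 0 ≤ (q.map (relEntropy I J)).sum :=
      List.sum_nonneg fun y hy => by
        obtain ⟨z, -, rfl⟩ := List.mem_map.1 hy
        exact relEntropy_nonneg I J z
    have hpos : ∀ w, 0 ≤ entropyGap (L * (I.outcomeProb (x, w) / J.outcomeProb (x, w))) +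
        (q.map (relEntropy I J)).sum := fun w =>
      add_nonneg (entropyGap_nonneg (mul_pos hL (hr w))) hs
    simp only [ev_feedback_cons, likelihoodRatio_cons, ← mul_assoc, ih (mul_pos hL (hr _)),
      ev_outcome]
    rw [← ENNReal.ofReal_mul (J.outcomeProb_pos _).le, ← ENNReal.ofReal_mul
      (J.outcomeProb_pos _).le, ← ENNReal.ofReal_add
      (mul_nonneg (J.outcomeProb_pos _).le (hpos _)) (mul_nonneg (J.outcomeProb_pos _).le (hpos _))]
    congr 1
    simp only [entropyGap, Real.log_mul hL.ne' (hr _).ne', List.map_cons, List.sum_cons,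
      relEntropy]
    have h3 := I.outcomeProb_add x
    have h4 := J.outcomeProb_add x
    have h5 : ∀ w, J.outcomeProb (x, w) * (L * (I.outcomeProb (x, w) / J.outcomeProb (x, w))) =
        L * I.outcomeProb (x, w) := by
      intro w
      have := (J.outcomeProb_pos (x, w)).ne'
      field_simp
    linear_combination h5 true + h5 false + L * h3 + ((q.map (relEntropy I J)).sum - 1 -
      Real.log L) * h4

end Likelihood

/-! ### The hard instances and their entropies -/

section Instances

variable {K : ℕ}

/-- The instance in which all arms are equally good. -/
def tieInstance (K : ℕ) : Instance K where
  gap _ _ := 0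
  antisymm _ _ := by simp
  lower _ _ := by norm_num
  upper _ _ := by norm_num

/-- The position of an arm when `i` is the best arm, `j` the second best, and the others tie. -/
def tier (i j x : Fin K) : ℕ := if x = i then 0 else if x = j then 1 else 2

/-- The gap between two tiers: `d` if the lower one is the second, `D` if it is the third. -/
def tierGap (d D : ℝ) (a b : ℕ) : ℝ :=
  if a < b then (if b = 1 then d else D) else if b < a then -(if a = 1 then d else D) else 0

theorem abs_tierGap_le {d D : ℝ} (hd : 0 ≤ d) (hdD : d ≤ D) (a b : ℕ) : |tierGap d D a b| ≤ D := by
  unfold tierGap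
  split_ifs <;> simp only [abs_neg, abs_zero, abs_of_nonneg hd, abs_of_nonneg (hd.trans hdD)] <;>
    linarith

theorem tier_le_two (i j x : Fin K) : tier i j x ≤ 2 := by
  unfold tier
  split_ifs <;> omega

/-- The instance in which arm `i` beats arm `j` with gap `d`, both beat all other arms with gap
`D`, and the other arms tie. -/
noncomputable def pairInstance (i j : Fin K) (d D : ℝ) (hd : 0 ≤ d) (hdD : d ≤ D)
    (hD : D ≤ 1 / 4) : Instance K where
  gap x y := tierGap d D (tier i j x) (tier i j y)
  antisymm x y := by
    unfold tierGap
    rcases lt_trichotomy (tier i j x) (tier i j y) with h | h | h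
    · simp [h, h.not_gt]
    · simp [h]
    · simp [h, h.not_gt]
  lower x y := by
    have := neg_abs_le (tierGap d D (tier i j x) (tier i j y))
    have := abs_tierGap_le hd hdD (tier i j x) (tier i j y)
    linarith
  upper x y := by
    have := le_abs_self (tierGap d D (tier i j x) (tier i j y))
    have := abs_tierGap_le hd hdD (tier i j x) (tier i j y)
    linarith

variable {i j : Fin K} {d D : ℝ} (hd : 0 ≤ d) (hdD : d ≤ D) (hD : D ≤ 1 / 4)

theorem exists_rank_tier (i j : Fin K) :
    ∃ rank : Equiv.Perm (Fin K), ∀ x y, rank x ≤ rank y → tier i j x ≤ tier i j y := by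
  refine ⟨(Tuple.sort (tier i j))⁻¹, fun x y hxy => ?_⟩
  have := Tuple.monotone_sort (tier i j) hxy
  simpa using this

theorem exists_rank_pairInstance :
    ∃ rank, (pairInstance i j d D hd hdD hD).SST rank ∧
      (pairInstance i j d D hd hdD hD).STI rank := by
  obtain ⟨rank, hrank⟩ := exists_rank_tier i j
  refine ⟨rank, fun x y z hxy hyz => ?_, fun x y z hxy hyz => ?_⟩
  all_goals
    have h1 := hrank _ _ hxy
    have h2 := hrank _ _ hyz
    have h3 := tier_le_two i j z
    simp only [pairInstance]
    generalize tier i j x = a at *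
    generalize tier i j y = b at *
    generalize tier i j z = c at *
    interval_cases c <;> interval_cases b <;> interval_cases a <;> simp [tierGap] <;> linarith

theorem pairInstance_gap_best_nonneg (x : Fin K) :
    0 ≤ (pairInstance i j d D hd hdD hD).gap i x := by
  simp only [pairInstance, tierGap, tier]
  split_ifs <;> linarith

theorem isCondorcetWinner_pairInstance :
    (pairInstance i j d D hd hdD hD).IsCondorcetWinner i := by
  intro x _
  have := pairInstance_gap_best_nonneg (i := i) (j := j) hd hdD hD x
  unfold Instance.prob
  linarith

theorem isMinGap_pairInstance (hij : i ≠ j) (hd' : 0 < d) :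
    (pairInstance i j d D hd hdD hD).IsMinGap i d := by
  refine ⟨⟨hd', j, ?_⟩, ?_⟩
  · simp [pairInstance, tierGap, tier, hij.symm]
  · rintro x ⟨hx, y, rfl⟩
    revert hx
    simp only [pairInstance, tierGap, tier]
    split_ifs <;> intro <;> linarith

/-- No arm is the best one in both instances, so every arm has gap at least `d` in one of them. -/
theorem le_gap_add_gap_pairInstance (hij : i ≠ j) (x : Fin K) :
    d ≤ (pairInstance i j d D hd hdD hD).gap i x + (pairInstance j i d D hd hdD hD).gap j x := by
  simp only [pairInstance, tierGap, tier]
  split_ifs <;> first | linarith | simp_all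

/-- Without a gap between the top two arms their order is invisible; this gives `(i, j)` and `(j,
i)` a common reference law. -/
theorem pairInstance_zero_swap (hD0 : 0 ≤ D) :
    pairInstance i j 0 D le_rfl hD0 hD = pairInstance j i 0 D le_rfl hD0 hD := by
  simp only [pairInstance, Instance.mk.injEq]
  funext x y
  simp only [tierGap, tier]
  split_ifs <;> simp_all

theorem relEntropy_pairInstance_tie_le (x : Fin K × Fin K) :
    relEntropy (pairInstance i j d D hd hdD hD) (tieInstance K) x ≤
      3 * D ^ 2 * ((if i = x.1 then 1 else 0) + (if j = x.1 then 1 else 0) +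
        (if i = x.2 then 1 else 0) + if j = x.2 then 1 else 0) := by
  by_cases h : i = x.1 ∨ j = x.1 ∨ i = x.2 ∨ j = x.2
  · refine (relEntropy_le (d := D) rfl (abs_tierGap_le hd hdD _ _) hD).trans ?_
    refine le_mul_of_one_le_right (by positivity) ?_
    rcases h with h | h | h | h <;> simp only [h, if_true] <;> split_ifs <;> norm_num
  · push Not at h
    obtain ⟨h1, h2, h3, h4⟩ := h
    rw [relEntropy_eq_zero]
    · simp [h1, h2, h3, h4]
    · simp [pairInstance, tierGap, tier, tieInstance, h1.symm, h2.symm, h3.symm, h4.symm]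

theorem pairInstance_gap_best_second (hij : i ≠ j) :
    (pairInstance i j d D hd hdD hD).gap i j = d := by
  simp [pairInstance, tierGap, tier, hij.symm]

theorem relEntropy_pairInstance_zero_le (hij : i ≠ j) (hD0 : 0 ≤ D) (x : Fin K × Fin K) :
    relEntropy (pairInstance i j d D hd hdD hD) (pairInstance i j 0 D le_rfl hD0 hD) x ≤
      3 * d ^ 2 * ((if (i, j) = x then 1 else 0) + if (i, j) = x.swap then 1 else 0) := by
  by_cases h : (i, j) = x ∨ (i, j) = x.swap
  · have h1 : 3 * d ^ 2 ≤ 3 * d ^ 2 * ((if (i, j) = x then 1 else 0) +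
        if (i, j) = x.swap then 1 else 0) := by
      refine le_mul_of_one_le_right (by positivity) ?_
      rcases h with h | h <;> rw [if_pos h] <;> split_ifs <;> norm_num
    have h2 := pairInstance_gap_best_second hd hdD hD hij
    have h3 := pairInstance_gap_best_second le_rfl hD0 hD hij
    refine (relEntropy_le (d := d) ?_ ?_ (hdD.trans hD)).trans h1
    · rcases h with rfl | h
      · exact h3
      · obtain ⟨rfl, rfl⟩ := Prod.mk.inj h
        rw [Instance.antisymm, h3, neg_zero]
    · rcases h with rfl | h
      · rw [h2, abs_of_nonneg hd]
      · obtain ⟨rfl, rfl⟩ := Prod.mk.inj h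
        rw [Instance.antisymm, h2, abs_neg, abs_of_nonneg hd]
  · push Not at h
    obtain ⟨h1, h2⟩ := h
    rw [relEntropy_eq_zero]
    · simp [h1, h2]
    · obtain ⟨a, b⟩ := x
      simp only [Prod.swap_prod_mk, Prod.mk.injEq, ne_eq] at h1 h2
      simp only [pairInstance, tierGap, tier]
      split_ifs <;> simp_all

theorem sum_offDiag_fst_eq (a : Fin K) :
    ∑ p ∈ (Finset.univ : Finset (Fin K)).offDiag, (if p.1 = a then (1 : ℝ) else 0) = K - 1 := by
  have : ((Finset.univ : Finset (Fin K)).offDiag.filter fun p => p.1 = a) =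
      (Finset.univ.erase a).image fun b => (a, b) := by
    ext ⟨x, y⟩
    simp
    grind
  rw [Finset.sum_boole, this, Finset.card_image_of_injective _ (Prod.mk_right_injective a),
    Finset.card_erase_of_mem (Finset.mem_univ a), Finset.card_univ, Fintype.card_fin,
    Nat.cast_sub (by have := a.pos; omega)]
  simp

theorem sum_offDiag_snd_eq (a : Fin K) :
    ∑ p ∈ (Finset.univ : Finset (Fin K)).offDiag, (if p.2 = a then (1 : ℝ) else 0) = K - 1 := by
  rw [← sum_offDiag_fst_eq a]
  refine Finset.sum_bij' (fun p _ => p.swap) (fun p _ => p.swap) ?_ ?_ ?_ ?_ ?_ <;>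
    simp [eq_comm]

theorem sum_offDiag_eq_le (x : Fin K × Fin K) :
    ∑ p ∈ (Finset.univ : Finset (Fin K)).offDiag, (if p = x then (1 : ℝ) else 0) ≤ 1 := by
  rw [Finset.sum_ite_eq']
  split_ifs <;> norm_num

/-- Each of the two arms in `x` lies in `2 (K - 1)` ordered pairs, and a pair avoiding both arms
contributes nothing. -/
theorem sum_relEntropy_pairInstance_tie_le (x : Fin K × Fin K) :
    ∑ p ∈ (Finset.univ : Finset (Fin K)).offDiag,
      relEntropy (pairInstance p.1 p.2 d D hd hdD hD) (tieInstance K) x ≤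
        12 * D ^ 2 * (K - 1) := by
  refine (Finset.sum_le_sum fun p _ => relEntropy_pairInstance_tie_le hd hdD hD x).trans_eq ?_
  rw [← Finset.mul_sum]
  simp only [Finset.sum_add_distrib, sum_offDiag_fst_eq, sum_offDiag_snd_eq]
  ring

/-- Only the two ordered pairs formed by the arms of `x` contribute, so no factor `K - 1` appears.
-/
theorem sum_relEntropy_pairInstance_zero_le (hD0 : 0 ≤ D) (x : Fin K × Fin K) :
    ∑ p ∈ (Finset.univ : Finset (Fin K)).offDiag,
      relEntropy (pairInstance p.1 p.2 d D hd hdD hD) (pairInstance p.1 p.2 0 D le_rfl hD0 hD) x ≤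
        6 * d ^ 2 := by
  refine (Finset.sum_le_sum fun p hp =>
    relEntropy_pairInstance_zero_le hd hdD hD (Finset.mem_offDiag.1 hp).2.2 hD0 x).trans ?_
  rw [← Finset.mul_sum]
  simp only [Prod.mk.eta, Finset.sum_add_distrib]
  nlinarith [sum_offDiag_eq_le x, sum_offDiag_eq_le x.swap, sq_nonneg d]

end Instances

/-! ### Regret as a function of the chosen comparisons -/

section Regret

variable {K T B : ℕ}

/-- The regret of a list of comparisons when arm `best` is the best one. -/
noncomputable def Instance.cost (I : Instance K) (best : Fin K) (q : Batch K) : ℝ :=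
  (q.map fun x => (I.gap best x.1 + I.gap best x.2) / 2).sum

theorem regret_eq_cost (I : Instance K) (best : Fin K) (h : History K) :
    regret I best h = I.cost best (h.flatten.map Prod.fst) := by
  simp [regret, Instance.cost, Function.comp_def]

theorem Instance.cost_append (I : Instance K) (best : Fin K) (q q' : Batch K) :
    I.cost best (q ++ q') = I.cost best q + I.cost best q' := by
  simp [cost]

theorem Instance.cost_nonneg {I : Instance K} {best : Fin K} (hI : ∀ x, 0 ≤ I.gap best x)
    (q : Batch K) : 0 ≤ I.cost best q :=
  List.sum_nonneg fun y hy => by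
    obtain ⟨x, -, rfl⟩ := List.mem_map.1 hy
    have := hI x.1
    have := hI x.2
    linarith

theorem Instance.cost_le {I : Instance K} {best : Fin K} {D : ℝ} (hI : ∀ x, I.gap best x ≤ D)
    (q : Batch K) : I.cost best q ≤ q.length * D := by
  induction q with
  | nil => simp [cost]
  | cons x q ih =>
    have h1 := hI x.1
    have h2 := hI x.2
    simp only [cost, List.map_cons, List.sum_cons, List.length_cons, Nat.cast_add,
      Nat.cast_one] at ih ⊢
    linarith

theorem le_cost_add_cost_pairInstance {i j : Fin K} {d D : ℝ} (hd : 0 ≤ d) (hdD : d ≤ D)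
    (hD : D ≤ 1 / 4) (hij : i ≠ j) (q : Batch K) :
    q.length * d ≤ (pairInstance i j d D hd hdD hD).cost i q +
      (pairInstance j i d D hd hdD hD).cost j q := by
  induction q with
  | nil => simp [Instance.cost]
  | cons x q ih =>
    have h1 := le_gap_add_gap_pairInstance hd hdD hD hij x.1
    have h2 := le_gap_add_gap_pairInstance hd hdD hD hij x.2
    simp only [Instance.cost, List.map_cons, List.sum_cons, List.length_cons, Nat.cast_add,
      Nat.cast_one] at ih ⊢
    linarith

theorem ev_regret_le (A : Algorithm K T B) (I : Instance K) (best : Fin K)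
    (h0 : ∀ x, 0 ≤ I.gap best x) {R : ℝ} (hR : expectedRegret A I best ≤ R) :
    (ev (law A I B) fun h => ENNReal.ofReal (I.cost best (h.flatten.map Prod.fst))) ≤
      ENNReal.ofReal R := by
  -- Finiteness is needed because `toReal` sends `⊤` to `0`; the cost is at most `T` on the support.
  have hup : ∀ x, I.gap best x ≤ 1 := fun x => by linarith [I.upper best x]
  have hfin : (ev (law A I B) fun h => ENNReal.ofReal (I.cost best (h.flatten.map Prod.fst))) ≠
      ⊤ := by
    refine ne_top_of_le_ne_top (ENNReal.ofReal_ne_top (r := T)) ?_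
    refine (ev_mono_support _ (g := fun _ => ENNReal.ofReal T) fun h hh => ?_).trans_eq
      (ev_const _ _)
    refine ENNReal.ofReal_le_ofReal ((Instance.cost_le hup _).trans ?_)
    rw [List.length_map, mul_one]
    exact_mod_cast size_le_of_mem_support_law A I B le_rfl h hh
  rw [← ENNReal.ofReal_toReal hfin]
  refine ENNReal.ofReal_le_ofReal (le_trans (le_of_eq ?_) hR)
  rw [ev, ENNReal.tsum_toReal_eq fun h => ENNReal.mul_ne_top (PMF.apply_ne_top _ _)
    ENNReal.ofReal_ne_top]
  refine tsum_congr fun h => ?_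
  rw [ENNReal.toReal_mul, ENNReal.toReal_ofReal (Instance.cost_nonneg h0 _), regret_eq_cost]

/-- The cost of batch `r + 1` is fixed once it is chosen, so it can be charged to the final regret
using the feedback of only `r` batches. -/
theorem ev_cost_step (A : Algorithm K T B) (I : Instance K) (best : Fin K)
    (h0 : ∀ x, 0 ≤ I.gap best x) {r : ℕ} (hr : r < B) :
    (ev (law A I r) fun h => ev (A.next h) fun q =>
        ENNReal.ofReal (I.cost best (h.flatten.map Prod.fst ++ q))) ≤
      ev (law A I B) fun h => ENNReal.ofReal (I.cost best (h.flatten.map Prod.fst)) := by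
  refine le_trans (le_of_eq ?_) (ev_law_mono A I _ (fun h o => ?_) (Nat.succ_le_of_lt hr))
  · rw [ev_law_succ]
    refine congrArg _ (funext fun h => congrArg _ (funext fun q => ?_))
    rw [← ev_const (I.feedback q) (ENNReal.ofReal (I.cost best (h.flatten.map Prod.fst ++ q)))]
    refine ev_congr_support _ fun o ho => ?_
    rw [List.flatten_append, List.flatten_singleton, List.map_append,
      map_fst_of_mem_support_feedback I q o ho]
  · refine ENNReal.ofReal_le_ofReal ?_
    rw [List.flatten_append, List.map_append, Instance.cost_append]
    exact le_add_of_nonneg_right (Instance.cost_nonneg h0 _)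

end Regret

/-! ### The entropy budget of short histories -/

section Potential

variable {K T B : ℕ}

theorem sum_map_finset_sum {ι α : Type*} (s : Finset ι) (f : ι → α → ℝ) (q : List α) :
    ∑ i ∈ s, (q.map (f i)).sum = (q.map fun x => ∑ i ∈ s, f i x).sum := by
  induction q with
  | nil => simp
  | cons x q ih => simp [Finset.sum_add_distrib, ih]

theorem sum_relEntropy_batch_le {ι : Type*} {s : Finset ι} {I J : ι → Instance K} {D : ℝ}
    (hD : ∀ x, ∑ i ∈ s, relEntropy (I i) (J i) x ≤ D) (q : Batch K) :
    ∑ i ∈ s, (q.map (relEntropy (I i) (J i))).sum ≤ q.length * D := by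
  rw [sum_map_finset_sum, ← nsmul_eq_mul]
  refine (List.sum_le_card_nsmul _ D fun y hy => ?_).trans_eq (by rw [List.length_map])
  obtain ⟨x, -, rfl⟩ := List.mem_map.1 hy
  exact hD x

/-- The total relative entropy accumulated by histories of size at most `S`, plus the entropy that
can still be accumulated, does not increase. -/
theorem ev_sum_entropyGap_le {ι : Type*} (A : Algorithm K T B) (s : Finset ι) (I : ι → Instance K)
    (J : Instance K) {D S : ℝ} (hD0 : 0 ≤ D) (hD : ∀ x, ∑ i ∈ s, relEntropy (I i) J x ≤ D)
    (hS : 0 ≤ S) (r : ℕ) :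
    (ev (law A J r) fun h => if (h.size : ℝ) ≤ S then
      ENNReal.ofReal (∑ i ∈ s, entropyGap (likelihoodRatio (I i) J h.flatten) +
        D * (S - h.size)) else 0) ≤ ENNReal.ofReal (D * S) := by
  induction r with
  | zero =>
    rw [ev_law_zero]
    simp [History.size, likelihoodRatio_nil, entropyGap, hS]
  | succ r ih =>
    refine le_trans ?_ ih
    rw [ev_law_succ]
    refine ev_mono _ fun h => ?_
    rw [← ev_const (A.next h) (ite _ _ _)]
    refine ev_mono _ fun q => ?_
    have hv : ∀ i o, 0 ≤ entropyGap (likelihoodRatio (I i) J o) := fun i o =>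
      entropyGap_nonneg (likelihoodRatio_pos _ _ _)
    by_cases hq : (h.size : ℝ) + q.length ≤ S
    · have hh : (h.size : ℝ) ≤ S := le_trans (le_add_of_nonneg_right (Nat.cast_nonneg _)) hq
      have hrest : 0 ≤ D * (S - (h.size + q.length)) := mul_nonneg hD0 (by linarith)
      calc _ = ev (J.feedback q) fun o => (∑ i ∈ s, ENNReal.ofReal (entropyGap
              (likelihoodRatio (I i) J h.flatten * likelihoodRatio (I i) J o))) +
              ENNReal.ofReal (D * (S - (h.size + q.length))) := by
            refine ev_congr_support _ fun o ho => ?_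
            rw [History.size_append_singleton, length_of_mem_support_feedback J q ho,
              Nat.cast_add, if_pos hq, ENNReal.ofReal_add
              (Finset.sum_nonneg fun i _ => hv i _) hrest,
              ENNReal.ofReal_sum_of_nonneg fun i _ => hv i _]
            simp only [List.flatten_append, List.flatten_singleton, likelihoodRatio_append]
        _ = ENNReal.ofReal (∑ i ∈ s, (entropyGap (likelihoodRatio (I i) J h.flatten) +
              (q.map (relEntropy (I i) J)).sum)) +
              ENNReal.ofReal (D * (S - (h.size + q.length))) := by
            have hs : ∀ i, 0 ≤ (q.map (relEntropy (I i) J)).sum := fun i =>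
              List.sum_nonneg fun y hy => by
                obtain ⟨z, -, rfl⟩ := List.mem_map.1 hy
                exact relEntropy_nonneg _ J z
            rw [ev_add, ev_const, ev_finset_sum,
              ENNReal.ofReal_sum_of_nonneg fun i _ => add_nonneg (hv i _) (hs i)]
            simp only [ev_feedback_entropyGap _ J q (likelihoodRatio_pos _ _ _)]
        _ ≤ _ := by
            rw [if_pos hh, ← ENNReal.ofReal_add ?_ hrest]
            · refine ENNReal.ofReal_le_ofReal ?_
              have := sum_relEntropy_batch_le (J := fun _ => J) hD q
              rw [Finset.sum_add_distrib]
              linarith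
            · refine Finset.sum_nonneg fun i _ => add_nonneg (hv i _) ?_
              exact List.sum_nonneg fun y hy => by
                obtain ⟨z, -, rfl⟩ := List.mem_map.1 hy
                exact relEntropy_nonneg _ J z
    -- A batch that overshoots `S` makes the potential vanish for good.
    · refine le_of_eq_of_le ((ev_congr_support _ fun o ho => ?_).trans
        (ev_const (J.feedback q) 0)) zero_le
      rw [History.size_append_singleton, length_of_mem_support_feedback J q ho,
        Nat.cast_add, if_neg hq]

end Potential

/-! ### Two-point inequality and averaging over pairs -/

section TwoPoint

/-- The two-point inequality behind all lower bounds: if the losses `y₁` and `y₂` add up to at least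
`z`, then after weighting by likelihood ratios at least `z / 2` is left, up to entropy terms. -/
theorem two_point_le {L₁ L₂ : ℝ} (h₁ : 0 < L₁) (h₂ : 0 < L₂) {y₁ y₂ z : ℝ≥0∞} (h : z ≤ y₁ + y₂) :
    ENNReal.ofReal (1 / 2) * z ≤ ENNReal.ofReal L₁ * y₁ + ENNReal.ofReal L₂ * y₂ +
      z * (ENNReal.ofReal (entropyGap L₁) + ENNReal.ofReal (entropyGap L₂)) := by
  -- Capping the loss at `z` keeps the entropy term proportional to `z`, while the two capped losses
  -- still add up to at least `z`.
  have key : ∀ {L : ℝ}, 0 < L → ∀ y : ℝ≥0∞, ENNReal.ofReal (1 / 2) * min y z ≤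
      ENNReal.ofReal L * y + z * ENNReal.ofReal (entropyGap L) := by
    intro L hL y
    calc ENNReal.ofReal (1 / 2) * min y z
        ≤ ENNReal.ofReal (L + entropyGap L) * min y z := by
          gcongr
          exact half_le_add_entropyGap hL
      _ = ENNReal.ofReal L * min y z + min y z * ENNReal.ofReal (entropyGap L) := by
          rw [ENNReal.ofReal_add hL.le (entropyGap_nonneg hL), add_mul, mul_comm (min y z)]
      _ ≤ _ := by
          gcongr
          · exact min_le_left _ _
          · exact min_le_right _ _
  have hz : z ≤ min y₁ z + min y₂ z := by
    rcases le_total y₁ z with h3 | h3 <;> rcases le_total y₂ z with h4 | h4 <;>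
      simp [h3, h4, h]
  calc ENNReal.ofReal (1 / 2) * z
      ≤ ENNReal.ofReal (1 / 2) * (min y₁ z + min y₂ z) := by gcongr
    _ ≤ (ENNReal.ofReal L₁ * y₁ + z * ENNReal.ofReal (entropyGap L₁)) +
        (ENNReal.ofReal L₂ * y₂ + z * ENNReal.ofReal (entropyGap L₂)) := by
        rw [mul_add]
        exact add_le_add (key h₁ y₁) (key h₂ y₂)
    _ = _ := by ring

theorem sum_offDiag_swap {K : ℕ} (f : Fin K × Fin K → ℝ≥0∞) :
    ∑ p ∈ (Finset.univ : Finset (Fin K)).offDiag, f p.swap =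
      ∑ p ∈ (Finset.univ : Finset (Fin K)).offDiag, f p := by
  refine Finset.sum_bij' (fun p _ => p.swap) (fun p _ => p.swap) ?_ ?_ ?_ ?_ ?_ <;>
    simp [eq_comm]

/-- Swapping permutes the ordered pairs, so summation turns `V p + V p.swap` into `2 W`, and
division by `K (K - 1)` yields the mean entropy. -/
theorem average_pairs_le {K : ℕ} (hK : 2 ≤ K) {F V : Fin K × Fin K → ℝ≥0∞} {P : ℝ≥0∞}
    {m R W : ℝ} (hm : 0 ≤ m) (hR0 : 0 ≤ R) (hW0 : 0 ≤ W) (hP : P ≤ 1)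
    (hR : ∀ p ∈ (Finset.univ : Finset (Fin K)).offDiag, F p ≤ ENNReal.ofReal R)
    (hW : ∑ p ∈ (Finset.univ : Finset (Fin K)).offDiag, V p ≤ ENNReal.ofReal W)
    (h : ∀ p ∈ (Finset.univ : Finset (Fin K)).offDiag,
      ENNReal.ofReal (1 / 2) * (ENNReal.ofReal m * P) ≤
        F p + F p.swap + ENNReal.ofReal m * (V p + V p.swap)) :
    P.toReal * m ≤ 4 * R + 4 * m * (W / (K * (K - 1))) := by
  have hsum := Finset.sum_le_sum h
  have hcard : ((Finset.univ : Finset (Fin K)).offDiag.card : ℝ) = K * (K - 1) := by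
    rw [Finset.offDiag_card, Finset.card_univ, Fintype.card_fin, Nat.cast_sub (by nlinarith)]
    push_cast
    ring
  have hF : ∑ p ∈ (Finset.univ : Finset (Fin K)).offDiag, F p ≤
      ENNReal.ofReal (K * (K - 1) * R) := by
    refine (Finset.sum_le_card_nsmul _ _ _ hR).trans_eq ?_
    rw [nsmul_eq_mul, ENNReal.ofReal_mul (by rw [← hcard]; positivity), ← hcard,
      ENNReal.ofReal_natCast]
  have hK1 : (2 : ℝ) ≤ K := by exact_mod_cast hK
  have hKK : (0 : ℝ) < K * (K - 1) := by nlinarith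
  rw [Finset.sum_const, nsmul_eq_mul, Finset.sum_add_distrib, Finset.sum_add_distrib,
    ← Finset.mul_sum, Finset.sum_add_distrib, sum_offDiag_swap F, sum_offDiag_swap V,
    ← ENNReal.ofReal_toReal (ne_top_of_le_ne_top ENNReal.one_ne_top hP),
    ← ENNReal.ofReal_natCast, hcard, ← ENNReal.ofReal_mul hm,
    ← ENNReal.ofReal_mul (by norm_num), ← ENNReal.ofReal_mul hKK.le] at hsum
  have h2 : ENNReal.ofReal (K * (K - 1) * (1 / 2 * (m * P.toReal))) ≤
      ENNReal.ofReal (K * (K - 1) * R + K * (K - 1) * R + m * (W + W)) := by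
    refine hsum.trans ?_
    rw [ENNReal.ofReal_add (by positivity) (by positivity),
      ENNReal.ofReal_add (by positivity) (by positivity), ENNReal.ofReal_mul hm,
      ENNReal.ofReal_add hW0 hW0]
    gcongr
  rw [ENNReal.ofReal_le_ofReal_iff (by positivity)] at h2
  have h3 : P.toReal * m * (K * (K - 1)) ≤
      (4 * R + 4 * m * (W / (K * (K - 1)))) * (K * (K - 1)) := by
    have : (4 * R + 4 * m * (W / (K * (K - 1)))) * (K * (K - 1)) =
        4 * R * (K * (K - 1)) + 4 * m * W := by
      rw [add_mul, mul_assoc (4 * m), div_mul_cancel₀ _ hKK.ne']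
    rw [this]
    nlinarith
  exact le_of_mul_le_mul_right h3 hKK

end TwoPoint

/-! ### Bounds for a single batch and for the last two batches -/

section Stages

variable {K T B : ℕ}

/-- If an algorithm has regret at most `R` on the instances with gap `d`, then a large batch
after few comparisons is unlikely when all arms are equal. -/
theorem prob_large_batch_le (hK : 2 ≤ K) (A : Algorithm K T B) {r : ℕ} (hr : r < B)
    {d S N R : ℝ} (hd : 0 ≤ d) (hd4 : d ≤ 1 / 4) (hS : 0 ≤ S) (hN : 0 ≤ N) (hR0 : 0 ≤ R)
    (hR : ∀ i j : Fin K, i ≠ j →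
      expectedRegret A (pairInstance i j d d hd le_rfl hd4) i ≤ R) :
    (ev (law A (tieInstance K) r) fun h => ev (A.next h) fun q =>
        if (h.size : ℝ) ≤ S ∧ N ≤ h.size + q.length then 1 else 0).toReal * (N * d) ≤
      4 * R + 48 * (N * d) * (d ^ 2 * S / K) := by
  have hK1 : (2 : ℝ) ≤ K := by exact_mod_cast hK
  set J := tieInstance K
  set I : Fin K × Fin K → Instance K := fun p => pairInstance p.1 p.2 d d hd le_rfl hd4 with hI
  set c : Fin K × Fin K → Batch K → ℝ≥0∞ := fun p q =>
    ENNReal.ofReal ((I p).cost p.1 q) with hc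
  set L : Fin K × Fin K → History K → ℝ := fun p h => likelihoodRatio (I p) J h.flatten with hL
  have hLpos : ∀ p h, 0 < L p h := fun p h => likelihoodRatio_pos _ _ _
  set F : Fin K × Fin K → ℝ≥0∞ := fun p => ev (law A J r) fun h =>
    ENNReal.ofReal (L p h) * ev (A.next h) fun q => c p (h.flatten.map Prod.fst ++ q) with hF
  set V : Fin K × Fin K → ℝ≥0∞ := fun p => ev (law A J r) fun h =>
    if (h.size : ℝ) ≤ S then ENNReal.ofReal (entropyGap (L p h)) else 0 with hV
  have hW0 : 0 ≤ 12 * d ^ 2 * ((K : ℝ) - 1) := by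
    have : (0 : ℝ) ≤ K - 1 := by linarith
    positivity
  have hVW : ∑ p ∈ (Finset.univ : Finset (Fin K)).offDiag, V p ≤
      ENNReal.ofReal (12 * d ^ 2 * (K - 1) * S) := by
    refine le_trans ?_ (ev_sum_entropyGap_le A (Finset.univ : Finset (Fin K)).offDiag I J hW0
      (sum_relEntropy_pairInstance_tie_le hd le_rfl hd4) hS r)
    rw [hV, ← ev_finset_sum]
    refine ev_mono _ fun h => ?_
    split_ifs with hh
    · rw [← ENNReal.ofReal_sum_of_nonneg fun p _ => entropyGap_nonneg (hLpos p h)]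
      refine ENNReal.ofReal_le_ofReal (le_add_of_nonneg_right ?_)
      exact mul_nonneg hW0 (by linarith)
    · simp
  have hFR : ∀ p ∈ (Finset.univ : Finset (Fin K)).offDiag, F p ≤ ENNReal.ofReal R := by
    intro p hp
    have h0 := pairInstance_gap_best_nonneg (i := p.1) (j := p.2) hd le_rfl hd4
    refine le_trans ?_ (ev_regret_le A (I p) p.1 h0 (hR p.1 p.2 (Finset.mem_offDiag.1 hp).2.2))
    refine le_trans (le_of_eq ?_) (ev_cost_step A (I p) p.1 h0 hr)
    rw [hF, ev_law_change A (I p) J]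
  have hmain : ∀ p ∈ (Finset.univ : Finset (Fin K)).offDiag,
      ENNReal.ofReal (1 / 2) * (ENNReal.ofReal (N * d) *
        (ev (law A J r) fun h => ev (A.next h) fun q =>
          if (h.size : ℝ) ≤ S ∧ N ≤ h.size + q.length then 1 else 0)) ≤
        F p + F p.swap + ENNReal.ofReal (N * d) * (V p + V p.swap) := by
    intro p hp
    simp only [hF, hV, ← ev_add, ← ev_const_mul]
    refine ev_mono _ fun h => ?_
    by_cases hh : (h.size : ℝ) ≤ S
    · simp only [hh, true_and, if_true, ev_add, ev_const_mul]
      set e : ℝ≥0∞ := ev (A.next h) fun q => if N ≤ h.size + q.length then 1 else 0 with he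
      have he1 : e ≤ 1 := ev_indicator_le_one _ _
      have hz : ENNReal.ofReal (N * d) * e ≤
          (ev (A.next h) fun q => c p (h.flatten.map Prod.fst ++ q)) +
          ev (A.next h) fun q => c p.swap (h.flatten.map Prod.fst ++ q) := by
        rw [he, ← ev_add, ← ev_const_mul]
        refine ev_mono _ fun q => ?_
        split_ifs with hq
        · rw [mul_one, hc, ← ENNReal.ofReal_add (Instance.cost_nonneg
            (pairInstance_gap_best_nonneg hd le_rfl hd4) _) (Instance.cost_nonneg
            (pairInstance_gap_best_nonneg hd le_rfl hd4) _)]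
          refine ENNReal.ofReal_le_ofReal (le_trans ?_ (le_cost_add_cost_pairInstance hd le_rfl hd4
            (Finset.mem_offDiag.1 hp).2.2 _))
          refine mul_le_mul_of_nonneg_right ?_ hd
          rw [List.length_append, List.length_map, Nat.cast_add]
          exact hq
        · simp
      refine (two_point_le (hLpos p h) (hLpos p.swap h) hz).trans ?_
      gcongr
      exact mul_le_of_le_one_right zero_le he1
    · simp [hh, ev_const]
  have hP : (ev (law A J r) fun h => ev (A.next h) fun q =>
      if (h.size : ℝ) ≤ S ∧ N ≤ h.size + q.length then 1 else 0) ≤ 1 :=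
    (ev_mono _ fun h => ev_indicator_le_one _ _).trans_eq (ev_const _ 1)
  refine (average_pairs_le hK (mul_nonneg hN hd) hR0 (mul_nonneg hW0 hS) hP hFR hVW
    hmain).trans_eq ?_
  have : (K : ℝ) - 1 ≠ 0 := by linarith
  have : (K : ℝ) ≠ 0 := by linarith
  field_simp
  ring

/-- If the last two batches start after few comparisons, then the last batch cannot tell which of
two top arms is the best one. -/
theorem prob_two_short_batches_le (hK : 2 ≤ K) (A : Algorithm K T B) {r : ℕ} (hr : r + 2 = B)
    {d D S S' R : ℝ} (hd : 0 ≤ d) (hdD : d ≤ D) (hD : D ≤ 1 / 4) (hS : 0 ≤ S) (hS' : 0 ≤ S')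
    (hST : S' ≤ T) (hR0 : 0 ≤ R)
    (hR : ∀ i j : Fin K, i ≠ j → expectedRegret A (pairInstance i j d D hd hdD hD) i ≤ R) :
    (ev (law A (tieInstance K) r) fun h => ev (A.next h) fun q =>
        if (h.size : ℝ) ≤ S ∧ (h.size : ℝ) + q.length ≤ S' then 1 else 0).toReal *
          ((T - S') * d) ≤
      4 * R + 4 * ((T - S') * d) * (12 * (D ^ 2 * S / K) + 6 * (d ^ 2 * S' / (K * (K - 1)))) := by
  have hK1 : (2 : ℝ) ≤ K := by exact_mod_cast hK
  have hD0 : 0 ≤ D := hd.trans hdD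
  set J := tieInstance K
  set I : Fin K × Fin K → Instance K := fun p => pairInstance p.1 p.2 d D hd hdD hD with hI
  set M : Fin K × Fin K → Instance K := fun p => pairInstance p.1 p.2 0 D le_rfl hD0 hD with hM
  have hMswap : ∀ p, M p.swap = M p := fun p => pairInstance_zero_swap hD hD0
  set c : Fin K × Fin K → Batch K → ℝ≥0∞ := fun p q =>
    ENNReal.ofReal ((I p).cost p.1 q) with hc
  have hgap : ∀ p : Fin K × Fin K, ∀ x, 0 ≤ (I p).gap p.1 x := fun p =>
    pairInstance_gap_best_nonneg hd hdD hD
  set L : Fin K × Fin K → History K → ℝ := fun p h => likelihoodRatio (I p) J h.flatten with hL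
  have hLpos : ∀ p h, 0 < L p h := fun p h => likelihoodRatio_pos _ _ _
  set ℓ : Fin K × Fin K → Feedback K → ℝ := fun p o => likelihoodRatio (I p) (M p) o with hℓ
  have hℓpos : ∀ p o, 0 < ℓ p o := fun p h => likelihoodRatio_pos _ _ _
  -- The history is reweighted from the tie instance, the penultimate batch from `M p`. Since `M
  -- p.swap = M p`, both orders of the pair are integrated against the same law.
  set F : Fin K × Fin K → ℝ≥0∞ := fun p => ev (law A J r) fun h => ev (A.next h) fun q =>
    ev ((M p).feedback q) fun o => ENNReal.ofReal (L p h * ℓ p o) *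
      ev (A.next (h ++ [o])) (c p) with hF
  set V : Fin K × Fin K → ℝ≥0∞ := fun p => ev (law A J r) fun h => ev (A.next h) fun q =>
    if (h.size : ℝ) ≤ S ∧ (h.size : ℝ) + q.length ≤ S' then
      ev ((M p).feedback q) fun o => ENNReal.ofReal (entropyGap (L p h * ℓ p o)) else 0 with hV
  have hW0 : 0 ≤ 12 * D ^ 2 * ((K : ℝ) - 1) := by
    have : (0 : ℝ) ≤ K - 1 := by linarith
    positivity
  have hVW : ∑ p ∈ (Finset.univ : Finset (Fin K)).offDiag, V p ≤
      ENNReal.ofReal (12 * D ^ 2 * (K - 1) * S + 6 * d ^ 2 * S') := by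
    rw [ENNReal.ofReal_add (mul_nonneg hW0 hS) (by positivity)]
    refine le_trans ?_ (add_le_add_left (ev_sum_entropyGap_le A
      (Finset.univ : Finset (Fin K)).offDiag I J hW0
      (sum_relEntropy_pairInstance_tie_le hd hdD hD) hS r) _)
    rw [hV, ← ev_finset_sum, ← ev_const (law A J r) (ENNReal.ofReal (6 * d ^ 2 * S')), ← ev_add]
    refine ev_mono _ fun h => ?_
    rw [← ev_finset_sum, ← ev_const (A.next h) (_ + _)]
    refine ev_mono _ fun q => ?_
    have hs : ∀ p, 0 ≤ (q.map (relEntropy (I p) (M p))).sum := fun p =>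
      List.sum_nonneg fun y hy => by
        obtain ⟨z, -, rfl⟩ := List.mem_map.1 hy
        exact relEntropy_nonneg _ _ z
    by_cases hh : (h.size : ℝ) ≤ S ∧ (h.size : ℝ) + q.length ≤ S'
    · simp only [hh, true_and, if_true, hℓ, ev_feedback_entropyGap _ _ q (hLpos _ h)]
      rw [← ENNReal.ofReal_sum_of_nonneg fun p _ =>
        add_nonneg (entropyGap_nonneg (hLpos p h)) (hs p), ← ENNReal.ofReal_add ?_ (by positivity)]
      · refine ENNReal.ofReal_le_ofReal ?_
        have h1 := sum_relEntropy_batch_le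
          (sum_relEntropy_pairInstance_zero_le (K := K) hd hdD hD hD0) q
        have h2 : (q.length : ℝ) * (6 * d ^ 2) ≤ S' * (6 * d ^ 2) := by
          refine mul_le_mul_of_nonneg_right ?_ (by positivity)
          linarith [hh.2, (Nat.cast_nonneg h.size : (0 : ℝ) ≤ h.size)]
        have h3 : 0 ≤ 12 * D ^ 2 * ((K : ℝ) - 1) * (S - h.size) :=
          mul_nonneg hW0 (by linarith [hh.1])
        rw [Finset.sum_add_distrib]
        linarith
      · exact add_nonneg (Finset.sum_nonneg fun p _ => entropyGap_nonneg (hLpos p h))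
          (mul_nonneg hW0 (by linarith [hh.1]))
    · simp [hh]
  have hFR : ∀ p ∈ (Finset.univ : Finset (Fin K)).offDiag, F p ≤ ENNReal.ofReal R := by
    intro p hp
    refine le_trans ?_ (ev_regret_le A (I p) p.1 (hgap p)
      (hR p.1 p.2 (Finset.mem_offDiag.1 hp).2.2))
    refine le_trans ?_ (ev_cost_step A (I p) p.1 (hgap p) (r := r + 1) (by omega))
    rw [ev_law_succ, ev_law_change A (I p) J]
    refine ev_mono _ fun h => ?_
    rw [← ev_const_mul]
    refine ev_mono _ fun q => ?_
    rw [ev_feedback_change (I p) (M p), ← ev_const_mul]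
    refine ev_mono _ fun o => ?_
    rw [ENNReal.ofReal_mul (hLpos p h).le, mul_assoc]
    gcongr
    refine ev_mono _ fun q' => ENNReal.ofReal_le_ofReal ?_
    rw [Instance.cost_append]
    exact le_add_of_nonneg_left (Instance.cost_nonneg (hgap p) _)
  have hmain : ∀ p ∈ (Finset.univ : Finset (Fin K)).offDiag,
      ENNReal.ofReal (1 / 2) * (ENNReal.ofReal ((T - S') * d) *
        (ev (law A J r) fun h => ev (A.next h) fun q =>
          if (h.size : ℝ) ≤ S ∧ (h.size : ℝ) + q.length ≤ S' then 1 else 0)) ≤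
        F p + F p.swap + ENNReal.ofReal ((T - S') * d) * (V p + V p.swap) := by
    intro p hp
    simp only [hF, hV, hMswap, ← ev_add, ← ev_const_mul]
    refine ev_mono_support _ fun h hh => ev_mono_support _ fun q hq => ?_
    split_ifs with hA
    · have hlen := length_of_mem_support_law A J r h hh
      have hsize := A.size_le h (by omega)
        (size_le_of_mem_support_law A J r (by omega) h hh) q hq
      simp only [← ev_add, ← ev_const_mul]
      rw [← ev_const ((M p).feedback q) (ENNReal.ofReal (1 / 2) * _)]
      refine ev_mono_support _ fun o ho => ?_
      have ho' := length_of_mem_support_feedback _ q ho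
      have hz : ENNReal.ofReal ((T - S') * d) ≤
          ev (A.next (h ++ [o])) (c p) + ev (A.next (h ++ [o])) (c p.swap) := by
        rw [← ev_add, ← ev_const (A.next (h ++ [o])) (ENNReal.ofReal _)]
        refine ev_mono_support _ fun q' hq' => ?_
        have hsz : History.size (h ++ [o]) = h.size + q.length := by
          rw [History.size_append_singleton, ho']
        -- The horizon must be used up, so the last batch has at least `T - S'` comparisons.
        have hT := A.size_eq (h ++ [o]) (by simp; omega) (by omega) q' hq'
        rw [hsz] at hT
        rw [hc, ← ENNReal.ofReal_add (Instance.cost_nonneg (hgap _) _)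
          (Instance.cost_nonneg (hgap _) _)]
        refine ENNReal.ofReal_le_ofReal (le_trans ?_ (le_cost_add_cost_pairInstance hd hdD hD
          (Finset.mem_offDiag.1 hp).2.2 _))
        refine mul_le_mul_of_nonneg_right ?_ hd
        rw [← hT]
        push_cast
        linarith [hA.2]
      have hℓs : ∀ o, 0 < ℓ p.swap o := hℓpos p.swap
      simpa only [mul_one, ev_add, ev_const_mul] using two_point_le (mul_pos (hLpos p h) (hℓpos p o))
        (mul_pos (hLpos p.swap h) (hℓs o)) hz
    · simp
  have hP : (ev (law A J r) fun h => ev (A.next h) fun q =>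
      if (h.size : ℝ) ≤ S ∧ (h.size : ℝ) + q.length ≤ S' then 1 else 0) ≤ 1 :=
    (ev_mono _ fun h => ev_indicator_le_one _ _).trans_eq (ev_const _ 1)
  refine (average_pairs_le hK (mul_nonneg (by linarith) hd) hR0
    (add_nonneg (mul_nonneg hW0 hS) (by positivity)) hP hFR hVW hmain).trans_eq ?_
  have : (K : ℝ) - 1 ≠ 0 := by linarith
  have : (K : ℝ) ≠ 0 := by linarith
  field_simp

end Stages

/-! ### Choice of gaps and thresholds, and the two cases -/

section LowerBound

variable {K T B : ℕ}

/-- The regret bound that is refuted: on every instance `pairInstance i j d D` the regret is at most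
`K a / (24576 B² d)`. -/
def SmallRegret (A : Algorithm K T B) (a : ℝ) : Prop :=
  ∀ (i j : Fin K) (d D : ℝ) (hd : 0 < d) (hdD : d ≤ D) (hD : D ≤ 1 / 4), i ≠ j →
    expectedRegret A (pairInstance i j d D hd.le hdD hD) i ≤ 1 / 24576 * (K * a / (B ^ 2 * d))

/-- The gap is the largest that keeps the entropy within `1 / (384 b)`, capped at `1 / 4`. The two
lower bounds on `N` serve the capped and the uncapped case respectively. -/
theorem exists_gap {k b a S N : ℝ} (hk : 0 < k) (hb : 0 < b) (ha : 0 < a)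
    (hN : k * a / (48 * b) ≤ N) (hNS : a / 2 * S ≤ N) :
    ∃ d : ℝ, 0 < d ∧ d ≤ 1 / 4 ∧ d ^ 2 * S / k ≤ 1 / (384 * b) ∧ k * a / (768 * b) ≤ N * d ^ 2 := by
  by_cases h : 24 * b * S ≤ k
  · refine ⟨1 / 4, by norm_num, le_rfl, ?_, ?_⟩
    · rw [div_le_div_iff₀ hk (by positivity)]
      linarith
    · rw [div_le_iff₀ (by positivity)] at hN ⊢
      linarith
  · push Not at h
    have hS : 0 < S := by
      by_contra hS
      nlinarith
    have hpos : 0 < k / (384 * b * S) := by positivity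
    refine ⟨Real.sqrt (k / (384 * b * S)), Real.sqrt_pos.2 hpos, ?_, ?_, ?_⟩
    · rw [Real.sqrt_le_left (by norm_num), div_le_iff₀ (by positivity)]
      linarith
    · rw [Real.sq_sqrt hpos.le]
      exact le_of_eq (by field_simp)
    · rw [Real.sq_sqrt hpos.le]
      calc k * a / (768 * b) = a / 2 * S * (k / (384 * b * S)) := by field_simp; norm_num
        _ ≤ _ := mul_le_mul_of_nonneg_right hNS hpos.le

theorem SmallRegret.prob_large_batch_le {A : Algorithm K T B} {a : ℝ} (hA : SmallRegret A a)
    (hK : 2 ≤ K) (ha : 0 < a) {r : ℕ} (hr : r < B) {S N : ℝ} (hS : 0 ≤ S)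
    (hN : K * a / (48 * B) ≤ N) (hNS : a / 2 * S ≤ N) :
    (ev (law A (tieInstance K) r) fun h => ev (A.next h) fun q =>
        if (h.size : ℝ) ≤ S ∧ N ≤ h.size + q.length then 1 else 0).toReal ≤ 1 / (4 * B) := by
  have hk : (0 : ℝ) < K := by exact_mod_cast (by omega : 0 < K)
  have hb : (0 : ℝ) < B := by exact_mod_cast (by omega : 0 < B)
  have hN0 : 0 < N := lt_of_lt_of_le (by positivity) hN
  obtain ⟨d, hd, hd4, h1, h2⟩ := exists_gap hk hb ha hN hNS
  have h := DuelingBandit.prob_large_batch_le hK A hr hd.le hd4 hS hN0.le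
    (R := 1 / 24576 * (K * a / (B ^ 2 * d))) (by positivity)
    fun i j hij => hA i j d d hd le_rfl hd4 hij
  set p := ENNReal.toReal _
  have hNd : 0 < N * d := by positivity
  have h3 : 1 / 24576 * (K * a / (B ^ 2 * d)) ≤ N * d * (1 / (32 * B)) := by
    calc 1 / 24576 * (K * a / (B ^ 2 * d)) = K * a / (768 * B) * (1 / (32 * B * d)) := by
          field_simp
          norm_num
      _ ≤ N * d ^ 2 * (1 / (32 * B * d)) := mul_le_mul_of_nonneg_right h2 (by positivity)
      _ = _ := by field_simp
  have h4 : 48 * (N * d) * (d ^ 2 * S / K) ≤ 48 * (N * d) * (1 / (384 * B)) :=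
    mul_le_mul_of_nonneg_left h1 (by positivity)
  refine le_of_mul_le_mul_right (h.trans ?_) hNd
  -- Regret and entropy contribute `1 / (8B)` each. Demanding `O(1/B)` from both is what costs `B²`.
  calc _ ≤ 4 * (N * d * (1 / (32 * B))) + 48 * (N * d) * (1 / (384 * (B : ℝ))) := by linarith
    _ = 1 / (4 * B) * (N * d) := by field_simp; norm_num

/-- The thresholds `0, u, u b, u b², …` for the numbers of comparisons. -/
def threshold (u b : ℝ) : ℕ → ℝ
  | 0 => 0
  | r + 1 => u * b ^ r

theorem ev_law_ne_top (A : Algorithm K T B) (I : Instance K) (r : ℕ) (P : History K → Prop)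
    [DecidablePred P] : (ev (law A I r) fun h => if P h then 1 else 0) ≠ ⊤ :=
  ne_top_of_le_ne_top ENNReal.one_ne_top (ev_indicator_le_one _ _)

theorem ev_law_next_ne_top (A : Algorithm K T B) (I : Instance K) (r : ℕ)
    (P : History K → Batch K → Prop) [∀ h, DecidablePred (P h)] :
    (ev (law A I r) fun h => ev (A.next h) fun q => if P h q then 1 else 0) ≠ ⊤ :=
  ne_top_of_le_ne_top ENNReal.one_ne_top
    ((ev_mono _ fun _ => ev_indicator_le_one _ _).trans_eq (ev_const _ 1))

theorem ev_law_succ_size (A : Algorithm K T B) (I : Instance K) (r : ℕ) (S : ℝ) :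
    (ev (law A I (r + 1)) fun h => if S < (h.size : ℝ) then 1 else 0) =
      ev (law A I r) fun h => ev (A.next h) fun q =>
        if S < (h.size : ℝ) + q.length then 1 else 0 := by
  rw [ev_law_succ]
  refine congrArg _ (funext fun h => congrArg _ (funext fun q => ?_))
  rw [← ev_const (I.feedback q) (ite _ _ _)]
  refine ev_congr_support _ fun o ho => ?_
  rw [History.size_append_singleton, length_of_mem_support_feedback I q ho, Nat.cast_add]

/-- To exceed threshold `r + 1`, either threshold `r` was already exceeded or a single batch jumps
over the gap between them, which costs another `1 / (4B)`. -/
theorem SmallRegret.prob_threshold_lt_size_le {A : Algorithm K T B} {a : ℝ} (hA : SmallRegret A a)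
    (hK : 2 ≤ K) (ha : 0 < a) {b : ℝ} (hb : 1 ≤ b) (hab : a / 2 ≤ b) {r : ℕ} (hr : r ≤ B) :
    (ev (law A (tieInstance K) r) fun h =>
      if threshold (K * a / (48 * B)) b r < (h.size : ℝ) then 1 else 0).toReal ≤ r / (4 * B) := by
  set u : ℝ := K * a / (48 * B) with hu
  have hu0 : 0 ≤ u := by positivity
  have hpos : ∀ s, 0 ≤ threshold u b s := by
    intro s
    cases s with
    | zero => exact le_rfl
    | succ s => exact mul_nonneg hu0 (pow_nonneg (by linarith) _)
  induction r with
  | zero => simp [ev_law_zero, threshold, History.size]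
  | succ r ih =>
    have h1 : u ≤ threshold u b (r + 1) := le_mul_of_one_le_right hu0 (one_le_pow₀ hb)
    have h2 : a / 2 * threshold u b r ≤ threshold u b (r + 1) := by
      refine (mul_le_mul_of_nonneg_right hab (hpos r)).trans ?_
      cases r with
      | zero => simpa [threshold] using hu0
      | succ s => exact le_of_eq (by simp only [threshold]; ring)
    have h3 := hA.prob_large_batch_le hK ha (by omega : r < B) (hpos r) h1 h2
    have h4 := ih (by omega)
    have h5 : (ev (law A (tieInstance K) (r + 1)) fun h =>
        if threshold u b (r + 1) < (h.size : ℝ) then 1 else 0) ≤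
        (ev (law A (tieInstance K) r) fun h => if threshold u b r < (h.size : ℝ) then 1 else 0) +
        ev (law A (tieInstance K) r) fun h => ev (A.next h) fun q =>
          if (h.size : ℝ) ≤ threshold u b r ∧ threshold u b (r + 1) ≤ h.size + q.length
            then 1 else 0 := by
      rw [ev_law_succ_size, ← ev_add]
      refine ev_mono _ fun h => ?_
      rw [← ev_const (A.next h) (if threshold u b r < (h.size : ℝ) then 1 else 0), ← ev_add]
      refine ev_mono _ fun q => ?_
      by_cases h6 : threshold u b r < (h.size : ℝ)
      · simp only [h6, if_true]
        exact le_add_right (by split_ifs <;> simp)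
      · push Not at h6
        split_ifs <;> simp_all [le_of_lt]
    have h6 := ENNReal.toReal_mono (ENNReal.add_ne_top.2
      ⟨ev_law_ne_top _ _ _ _, ev_law_next_ne_top _ _ _ _⟩) h5
    rw [ENNReal.toReal_add (ev_law_ne_top _ _ _ _) (ev_law_next_ne_top _ _ _ _)] at h6
    refine h6.trans ((add_le_add h4 h3).trans_eq ?_)
    push_cast
    ring

theorem not_smallRegret_of_card_le {A : Algorithm K T B} {a : ℝ} (hK : 2 ≤ K) (hB : 1 < B)
    (hKT : K ≤ T) (haT : a ^ B = T) (ha : 1 ≤ a) (hKB : K ≤ 36 * B ^ 2) : ¬ SmallRegret A a := by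
  intro hA
  have hk : (2 : ℝ) ≤ K := by exact_mod_cast hK
  have hb : (2 : ℝ) ≤ B := by exact_mod_cast hB
  have hKT' : (K : ℝ) ≤ T := by exact_mod_cast hKT
  have hKB' : (K : ℝ) ≤ 36 * B ^ 2 := by exact_mod_cast hKB
  obtain ⟨n, rfl⟩ : ∃ n, B = n + 1 := ⟨B - 1, by omega⟩
  have hlt : threshold (K * a / (48 * (n + 1 : ℕ))) (max 1 (a / 2)) (n + 1) < T := by
    simp only [threshold]
    -- For `a ≤ 2` the thresholds are constant and `K ≤ T` suffices. Otherwise the halved ratio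
    -- gains `2 ^ (B - 1) ≥ B`, which absorbs `K ≤ 36 B²`.
    rcases le_total (a / 2) 1 with h | h
    · rw [max_eq_left h, one_pow, mul_one, div_lt_iff₀ (by positivity)]
      nlinarith
    · rw [max_eq_right h, ← haT]
      have h2 : ((n + 1 : ℕ) : ℝ) ≤ 2 ^ n := by exact_mod_cast Nat.lt_two_pow_self
      have h3 : (K : ℝ) < 48 * (n + 1 : ℕ) * 2 ^ n := by nlinarith
      calc K * a / (48 * (n + 1 : ℕ)) * (a / 2) ^ n
          = K / (48 * (n + 1 : ℕ) * 2 ^ n) * a ^ (n + 1) := by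
            rw [div_pow, pow_succ]
            field_simp
        _ < 1 * a ^ (n + 1) := by
            refine mul_lt_mul_of_pos_right ?_ (by positivity)
            rwa [div_lt_one (by positivity)]
        _ = _ := one_mul _
  have h := hA.prob_threshold_lt_size_le hK (by linarith) (le_max_left 1 (a / 2))
    (le_max_right 1 (a / 2)) le_rfl
  have h1 : (ev (law A (tieInstance K) (n + 1)) fun h =>
      if threshold (K * a / (48 * (n + 1 : ℕ))) (max 1 (a / 2)) (n + 1) < (h.size : ℝ)
        then 1 else 0) = 1 := by
    refine (ev_congr_support _ fun h hh => ?_).trans (ev_const _ 1)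
    rw [size_eq_of_mem_support_law A _ (by omega) h hh, if_pos hlt]
  rw [h1, ENNReal.toReal_one, le_div_iff₀ (by positivity)] at h
  linarith

set_option maxHeartbeats 400000 in
theorem not_smallRegret_of_pow_le {A : Algorithm K T B} {a : ℝ} (hK : 2 ≤ K) (hB : 1 < B)
    (haT : a ^ B = T) (hKa : K ≤ a) : ¬ SmallRegret A a := by
  intro hA
  have hk : (2 : ℝ) ≤ K := by exact_mod_cast hK
  obtain ⟨r, rfl⟩ : ∃ r, B = r + 2 := ⟨B - 2, by omega⟩
  set b : ℝ := ((r + 2 : ℕ) : ℝ) with hbdef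
  have hb : (2 : ℝ) ≤ b := by
    rw [hbdef]
    exact_mod_cast hB
  have ha : 2 ≤ a := hk.trans hKa
  have hr : 0 < a ^ r := by positivity
  set u : ℝ := K * a / (48 * b) with hu
  have hS : threshold u a r ≤ K * a ^ r / (48 * b) := by
    cases r with
    | zero => simp only [threshold]; positivity
    | succ s => exact le_of_eq (by simp only [threshold, hu]; ring)
  have hS0 : 0 ≤ threshold u a r := by
    cases r with
    | zero => exact le_rfl
    | succ s => simp only [threshold]; positivity
  have hS' : threshold u a (r + 1) = K * a ^ (r + 1) / (48 * b) := by
    simp only [threshold, hu]; ring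
  have hT : (T : ℝ) = a ^ (r + 1) * a := by rw [← haT]; ring
  have hST : threshold u a (r + 1) ≤ T / 2 := by
    rw [hS', hT, div_le_iff₀ (by positivity)]
    have h1 : a ^ (r + 1) * K ≤ a ^ (r + 1) * a := by gcongr
    have h2 : 0 ≤ a ^ (r + 1) * a := by positivity
    nlinarith
  have hT0 : (0 : ℝ) < T := by rw [hT]; positivity
  -- `D² S / K` and `d² S' / (K (K - 1))` are then `O(1/B)` at the two thresholds, while `T d² = K a
  -- / 16`. The condition `d ≤ D` amounts to `K ≤ a`.
  set D : ℝ := Real.sqrt (1 / (16 * a ^ r)) with hDdef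
  set d : ℝ := Real.sqrt (K / (16 * a ^ (r + 1))) with hddef
  have hD2 : D ^ 2 = 1 / (16 * a ^ r) := Real.sq_sqrt (by positivity)
  have hd2 : d ^ 2 = K / (16 * a ^ (r + 1)) := Real.sq_sqrt (by positivity)
  have hd : 0 < d := Real.sqrt_pos.2 (by positivity)
  have hdD : d ≤ D := by
    refine Real.sqrt_le_sqrt ?_
    rw [div_le_div_iff₀ (by positivity) (by positivity), pow_succ]
    nlinarith
  have hD4 : D ≤ 1 / 4 := by
    rw [hDdef, Real.sqrt_le_left (by norm_num), div_le_iff₀ (by positivity)]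
    linarith [one_le_pow₀ (by linarith : 1 ≤ a) (n := r)]
  have h := prob_two_short_batches_le hK A rfl hd.le hdD hD4 hS0
    (S' := threshold u a (r + 1)) (by rw [hS']; positivity) (by linarith)
    (R := 1 / 24576 * (K * a / (b ^ 2 * d))) (by positivity)
    fun i j hij => hA i j d D hd hdD hD4 hij
  have h1 := hA.prob_threshold_lt_size_le hK (by linarith) (by linarith : 1 ≤ a)
    (by linarith) (by omega : r ≤ r + 2)
  have h2 := hA.prob_threshold_lt_size_le hK (by linarith) (by linarith : 1 ≤ a)
    (by linarith) (by omega : r + 1 ≤ r + 2)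
  have h3 : (1 : ℝ≥0∞) ≤
      (ev (law A (tieInstance K) r) fun h => if threshold u a r < (h.size : ℝ) then 1 else 0) +
      (ev (law A (tieInstance K) (r + 1)) fun h =>
        if threshold u a (r + 1) < (h.size : ℝ) then 1 else 0) +
      ev (law A (tieInstance K) r) fun h => ev (A.next h) fun q =>
        if (h.size : ℝ) ≤ threshold u a r ∧ (h.size : ℝ) + q.length ≤ threshold u a (r + 1)
          then 1 else 0 := by
    rw [ev_law_succ_size, ← ev_add, ← ev_add]
    refine (ev_const (law A (tieInstance K) r) 1).symm.trans_le (ev_mono _ fun h => ?_)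
    rw [← ev_const (A.next h) (if threshold u a r < (h.size : ℝ) then 1 else 0), ← ev_add,
      ← ev_add]
    refine (ev_const (A.next h) 1).symm.trans_le (ev_mono _ fun q => ?_)
    split_ifs <;> simp_all
  have h4 := ENNReal.toReal_mono (ENNReal.add_ne_top.2 ⟨ENNReal.add_ne_top.2
    ⟨ev_law_ne_top _ _ _ _, ev_law_ne_top _ _ _ _⟩, ev_law_next_ne_top _ _ _ _⟩) h3
  rw [ENNReal.toReal_add (ENNReal.add_ne_top.2
    ⟨ev_law_ne_top _ _ _ _, ev_law_ne_top _ _ _ _⟩) (ev_law_next_ne_top _ _ _ _),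
    ENNReal.toReal_add (ev_law_ne_top _ _ _ _) (ev_law_ne_top _ _ _ _), ENNReal.toReal_one] at h4
  set p := ENNReal.toReal (ev (law A (tieInstance K) r) fun h => ev (A.next h) fun q =>
        if (h.size : ℝ) ≤ threshold u a r ∧ (h.size : ℝ) + q.length ≤ threshold u a (r + 1)
          then 1 else 0)
  -- The two overshoot probabilities are at most `1 / 4` each.
  have hp : 1 / 2 ≤ p := by
    have h5 : (r : ℝ) / (4 * b) ≤ 1 / 4 := by
      rw [div_le_div_iff₀ (by positivity) (by norm_num), hbdef]
      push_cast
      linarith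
    have h6 : ((r + 1 : ℕ) : ℝ) / (4 * b) ≤ 1 / 4 := by
      rw [div_le_div_iff₀ (by positivity) (by norm_num), hbdef]
      push_cast
      linarith
    linarith
  have h7 : D ^ 2 * threshold u a r / K ≤ 1 / 1536 := by
    calc D ^ 2 * threshold u a r / K ≤ D ^ 2 * (K * a ^ r / (48 * b)) / K := by gcongr
      _ = 1 / (768 * b) := by rw [hD2]; field_simp; norm_num
      _ ≤ 1 / 1536 := one_div_le_one_div_of_le (by norm_num) (by linarith)
  have h8 : d ^ 2 * threshold u a (r + 1) / (K * (K - 1)) ≤ 1 / 768 := by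
    rw [hd2, hS']
    have hk1 : (0 : ℝ) < K - 1 := by linarith
    calc (K : ℝ) / (16 * a ^ (r + 1)) * (K * a ^ (r + 1) / (48 * b)) / (K * (K - 1))
        = K / (768 * b * (K - 1)) := by field_simp; norm_num
      _ ≤ 1 / 768 := by
        have h2b : 2 * ((K : ℝ) - 1) ≤ b * (K - 1) := mul_le_mul_of_nonneg_right hb hk1.le
        rw [div_le_div_iff₀ (by positivity) (by norm_num)]
        linarith
  have h9 : T / 2 * d ≤ (T - threshold u a (r + 1)) * d :=
    mul_le_mul_of_nonneg_right (by linarith) hd.le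
  set N := (T - threshold u a (r + 1)) * d
  have hN : 0 < N := lt_of_lt_of_le (by positivity) h9
  have h10 : 1 / 2 * N ≤ p * N := mul_le_mul_of_nonneg_right hp hN.le
  have h11 : 4 * N * (12 * (D ^ 2 * threshold u a r / K) +
      6 * (d ^ 2 * threshold u a (r + 1) / (K * (K - 1)))) ≤ 4 * N * (1 / 64) :=
    mul_le_mul_of_nonneg_left (by linarith) (by linarith)
  -- The entropy terms take `1 / 16` from `p ≥ 1 / 2`, leaving `7 / 16`; the last batch having at
  -- least `T / 2` comparisons halves this again.
  have h12 : 7 / 32 * (T * d) ≤ 1 / 6144 * (K * a / (b ^ 2 * d)) := by linarith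
  have h13 : 7 / 32 * (T * d ^ 2) ≤ 1 / 6144 * (K * a / b ^ 2) := by
    calc 7 / 32 * (T * d ^ 2) = 7 / 32 * (T * d) * d := by ring
      _ ≤ 1 / 6144 * (K * a / (b ^ 2 * d)) * d := mul_le_mul_of_nonneg_right h12 hd.le
      _ = _ := by field_simp
  have h14 : T * d ^ 2 = K * a / 16 := by
    rw [hd2, hT]
    field_simp
  have h15 : K * a / b ^ 2 ≤ K * a := div_le_self (by positivity) (one_le_pow₀ (by linarith))
  have h16 : 0 < K * a := by positivity
  rw [h14] at h13
  linarith

end LowerBound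

end DuelingBandit

theorem mainTheorem5 :
    ∃ c : ℝ, 0 < c ∧
      ∀ B K T : ℕ, 1 < B → 2 ≤ K → K ≤ T → (K ≤ 36 * B ^ 2 ∨ K ^ B ≤ T) →
        ∀ A : DuelingBandit.Algorithm K T B,
          ∃ (I : DuelingBandit.Instance K) (rank : Equiv.Perm (Fin K)) (best : Fin K) (e : ℝ),
            I.SST rank ∧ I.STI rank ∧ I.IsCondorcetWinner best ∧ I.IsMinGap best e ∧
            c * (K * (T : ℝ) ^ (1 / (B : ℝ)) / ((B : ℝ) ^ 2 * e)) ≤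
              DuelingBandit.expectedRegret A I best := by
  refine ⟨1 / 24576, by norm_num, fun B K T hB hK hKT h A => ?_⟩
  set a : ℝ := (T : ℝ) ^ (1 / (B : ℝ)) with ha
  have hT1 : (1 : ℝ) ≤ T := by exact_mod_cast (by omega : 1 ≤ T)
  have ha1 : 1 ≤ a := Real.one_le_rpow hT1 (by positivity)
  have haT : a ^ B = T := by
    rw [ha, one_div, Real.rpow_inv_natCast_pow (by linarith) (by omega)]
  have hnot : ¬ DuelingBandit.SmallRegret A a := by
    rcases h with h | h
    · exact DuelingBandit.not_smallRegret_of_card_le hK hB hKT haT ha1 h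
    · refine DuelingBandit.not_smallRegret_of_pow_le hK hB haT ?_
      rw [← pow_le_pow_iff_left₀ (Nat.cast_nonneg K) (by linarith) (by omega : B ≠ 0), haT]
      exact_mod_cast h
  unfold DuelingBandit.SmallRegret at hnot
  push Not at hnot
  obtain ⟨i, j, d, D, hd, hdD, hD, hij, hlt⟩ := hnot
  obtain ⟨rank, hSST, hSTI⟩ := DuelingBandit.exists_rank_pairInstance (i := i) (j := j) hd.le hdD hD
  exact ⟨_, rank, i, d, hSST, hSTI, DuelingBandit.isCondorcetWinner_pairInstance hd.le hdD hD,
    DuelingBandit.isMinGap_pairInstance hd.le hdD hD hij hd, hlt.le⟩
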